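/- For a finite graph $G=(V,E)$, a function $f:V\to\mathbb{R}$ is Lipschitz if $|f(v)-f(w)|\le 1$ for all adjacent $v,w\in V$. Let $\operatorname{Var}(f)=\frac1{|V|}\sum_{v\in V}(f(v)-\bar f)^2$ with $\bar f=\frac1{|V|}\sum_{v\in V}f(v)$, that is, the variance of $f$ at a uniformly random vertex. The spread of $G$ is $\operatorname{spr}(G)=\sup\{\operatorname{Var}(f): f \text{ Lipschitz on } G\}\in[0,\infty]$ (it is $\infty$ if $G$ is disconnected). For integers $d\ge 0$ and $n$ with $nd$ even, $d<n$, let $G_{n,d}$ be uniformly distributed over the $d$-regular simple graphs with vertex set $\{1,\dots,n\}$. Theorem. For each $\varepsilon>0$ there exists $d_0$ such that, for each fixed $d\ge d_0$, $$\mathbb{P}\bigl(\operatorname{spr}(G_{n,d})<\tfrac14+\varepsilon\bigr)\to 1$$ as $n\to\infty$ through the integers $n$ such that $nd$ is even. -/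

import Mathlib

namespace GraphSpread

/-- A Lipschitz function on a graph: real values at adjacent vertices differ by at most `1`. -/
def IsLipschitz {V : Type*} (G : SimpleGraph V) (f : V → ℝ) : Prop :=
  ∀ v w : V, G.Adj v w → |f v - f w| ≤ 1

/-- The mean of `f` at a uniformly distributed vertex. -/
noncomputable def mean {V : Type*} [Fintype V] (f : V → ℝ) : ℝ :=
  (∑ v, f v) / (Fintype.card V : ℝ)

/-- The variance of `f` at a uniformly distributed vertex. -/
noncomputable def variance {V : Type*} [Fintype V] (f : V → ℝ) : ℝ :=
  (∑ v, (f v - mean f) ^ 2) / (Fintype.card V : ℝ)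

/-- The spread of a finite graph: the supremum of the variances of its Lipschitz functions.
It is taken in the extended reals, so that it is `⊤` when the variances are unbounded
(which, for a nonempty graph, happens exactly when the graph is disconnected). -/
noncomputable def spread {V : Type*} [Fintype V] (G : SimpleGraph V) : EReal :=
  ⨆ (f : V → ℝ) (_ : IsLipschitz G f), ((variance f : ℝ) : EReal)

open Classical in
/-- The `d`-regular simple graphs on the labelled vertex set `Fin n`. -/
def regularGraphs (n d : ℕ) : Set (SimpleGraph (Fin n)) :=
  {G | G.IsRegularOfDegree d}

/-- The probability that the random `d`-regular graph on `n` vertices, uniformly distributed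
over `regularGraphs n d`, has the property `P`. (There is such a graph iff `n * d` is even
and `d < n`, apart from the case `n = 0`; when there is none, the value is `0`.) -/
noncomputable def regularProb (n d : ℕ) (P : SimpleGraph (Fin n) → Prop) : ℝ :=
  ({G | G ∈ regularGraphs n d ∧ P G}.ncard : ℝ) / ((regularGraphs n d).ncard : ℝ)

/-- The random `d`-regular graph has the property `P` with high probability: the probability
tends to `1` as `n → ∞` through the `n` for which `n * d` is even. -/
def RegularWhp (d : ℕ) (P : ∀ n : ℕ, SimpleGraph (Fin n) → Prop) : Prop :=
  Filter.Tendsto (fun n : ℕ => regularProb n d (P n))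
    (Filter.atTop ⊓ Filter.principal {n : ℕ | Even (n * d)}) (nhds 1)

end GraphSpread

/-! Two expansion properties, each holding with high probability, force the bound. (i) Any two
disjoint sets of at least `δ * n` vertices are joined by an edge. (ii) No nonempty set `T` of at
most `n / 55296` vertices spans `(d / 4) * #T` edges or more. Given a Lipschitz `f`, let `a` be the
level at which the proportion of vertices with `f v ≤ a` first reaches `δ`. Fewer than `δ * n`
vertices lie below `a`. By (i), fewer than `δ * n` lie above `a + 1`, since no edge crosses a gap
longer than `1`. Moving one further unit away from `[a, a + 1]` at least halves these tails: all
neighbours of the farther tail lie in the nearer one, so otherwise the nearer one would be too dense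
for (ii). The second moment about `a + 1 / 2` is thus at most `1 / 4` plus a geometrically
convergent tail, in all `1 / 4 + 16 * δ` (`variance_le_of_expansion`).

Both properties come from switchings, which replace edges `au`, `bv` by `ab`, `uv` and keep all
degrees. Counting switchings between two families of regular graphs from both sides compares their
sizes (`card_mul_le_card_mul_of_switch`). Destroying prescribed edges one at a time gives
`card_containing_mul_le`, and a union bound gives (ii), with failure probability at most `110592 /
n`. Creating edges between `A` and `B` gives `card_crossCard_eq_zero_mul_le`, with probability at
most `8⁻ⁿ` per pair; this beats the `4ⁿ` pairs and gives (i). -/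

namespace GraphSpread
section
open scoped Classical
open Finset

/-! ### Switchings and double counting. -/

section

variable {V : Type*}

/-- Replace the edges `au`, `bv` of `G` by `ab`, `uv`. -/
noncomputable def switch (G : SimpleGraph V) (a u b v : V) : SimpleGraph V :=
  SimpleGraph.fromEdgeSet ((G.edgeSet \ {s(a, u), s(b, v)}) ∪ {s(a, b), s(u, v)})

/-- The quadruples at which a switching yields a graph with the same degrees. -/
structure IsSwitchable (G : SimpleGraph V) (a u b v : V) : Prop where
  adj_left : G.Adj a u
  adj_right : G.Adj b v
  not_adj_left : ¬ G.Adj a b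
  not_adj_right : ¬ G.Adj u v
  ne_left : a ≠ b
  ne_right : u ≠ v

theorem switch_adj (G : SimpleGraph V) (a u b v x y : V) :
    (switch G a u b v).Adj x y ↔
      ((G.Adj x y ∧ s(x, y) ≠ s(a, u) ∧ s(x, y) ≠ s(b, v)) ∨ s(x, y) = s(a, b) ∨
        s(x, y) = s(u, v)) ∧ x ≠ y := by
  simp only [switch, SimpleGraph.fromEdgeSet_adj, Set.mem_union, Set.mem_sdiff,
    SimpleGraph.mem_edgeSet, Set.mem_insert_iff, Set.mem_singleton_iff, not_or, ne_eq]

/-- Exchanging the two middle vertices gives the inverse switching, so the old graph is recovered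
from the new one and the quadruple. -/
theorem IsSwitchable.switch_switch {G : SimpleGraph V} {a u b v : V}
    (h : IsSwitchable G a u b v) : switch (switch G a u b v) a b u v = G := by
  obtain ⟨h1, h2, h3, h4, h5, h6⟩ := h
  have h7 : a ≠ u := h1.ne
  have h8 : b ≠ v := h2.ne
  have h1' := h1.symm
  have h2' := h2.symm
  have h3' : ¬ G.Adj b a := fun h => h3 h.symm
  have h4' : ¬ G.Adj v u := fun h => h4 h.symm
  ext x y
  have hxy : G.Adj x y → x ≠ y := fun h => h.ne
  simp only [switch_adj, Sym2.eq_iff, ne_eq]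
  grind

theorem IsSwitchable.symm {G : SimpleGraph V} {a u b v : V}
    (h : IsSwitchable G a u b v) : IsSwitchable G b v a u :=
  ⟨h.2, h.1, fun t => h.3 t.symm, fun t => h.4 t.symm, h.5.symm, h.6.symm⟩

theorem IsSwitchable.flip {G : SimpleGraph V} {a u b v : V}
    (h : IsSwitchable G a u b v) : IsSwitchable G u a v b :=
  ⟨h.1.symm, h.2.symm, h.4, h.3, h.6, h.5⟩

theorem switch_symm (G : SimpleGraph V) (a u b v : V) : switch G a u b v = switch G b v a u := by
  rw [switch, switch, Set.pair_comm, Sym2.eq_swap (a := a) (b := b), Sym2.eq_swap (a := u) (b := v)]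

theorem switch_flip (G : SimpleGraph V) (a u b v : V) : switch G a u b v = switch G u a v b := by
  rw [switch, switch, Set.pair_comm s(a, b), Sym2.eq_swap (a := a) (b := u),
    Sym2.eq_swap (a := b) (b := v)]

variable [Fintype V]

theorem IsSwitchable.card_neighbors_left {G : SimpleGraph V} {a u b v : V}
    (h : IsSwitchable G a u b v) :
    #{y | (switch G a u b v).Adj a y} = #{y | G.Adj a y} := by
  obtain ⟨h1, h2, h3, h4, h5, h6⟩ := h
  have h7 : a ≠ u := h1.ne
  have h8 : b ≠ v := h2.ne
  have h9 : a ≠ v := by rintro rfl; exact h3 h2.symm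
  have : ({y | (switch G a u b v).Adj a y} : Finset V)
      = insert b (({y | G.Adj a y} : Finset V).erase u) := by
    ext y
    have hxy : G.Adj a y → a ≠ y := fun h => h.ne
    simp only [switch_adj, Sym2.eq_iff, ne_eq, mem_filter, mem_univ, true_and, mem_insert,
      mem_erase]
    grind
  rw [this, card_insert_of_notMem (by simp [h3]), card_erase_add_one (by simpa using h1)]

/-- Each of the four vertices loses one neighbour and gains one; the symmetries of the quadruple
reduce all four cases to `a`. -/
theorem IsSwitchable.card_neighbors {G : SimpleGraph V} {a u b v : V}
    (h : IsSwitchable G a u b v) (x : V) :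
    #{y | (switch G a u b v).Adj x y} = #{y | G.Adj x y} := by
  by_cases hxa : x = a
  · subst hxa; exact h.card_neighbors_left
  by_cases hxb : x = b
  · subst hxb; rw [switch_symm]; exact h.symm.card_neighbors_left
  by_cases hxu : x = u
  · subst hxu; rw [switch_flip]; exact h.flip.card_neighbors_left
  by_cases hxv : x = v
  · subst hxv; rw [switch_flip, switch_symm]; exact h.flip.symm.card_neighbors_left
  congr 1
  ext y
  have hxy : G.Adj x y → x ≠ y := fun h => h.ne
  simp only [switch_adj, Sym2.eq_iff, ne_eq, mem_filter, mem_univ, true_and]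
  grind

variable (V) in
/-- The `d`-regular graphs on `V`. -/
noncomputable def regularFinset (d : ℕ) : Finset (SimpleGraph V) :=
  {G | ∀ x, #{y | G.Adj x y} = d}

theorem mem_regularFinset {d : ℕ} {G : SimpleGraph V} :
    G ∈ regularFinset V d ↔ ∀ x, #{y | G.Adj x y} = d := by
  simp [regularFinset]

theorem IsSwitchable.switch_mem {G : SimpleGraph V} {a u b v : V} {d : ℕ}
    (h : IsSwitchable G a u b v) (hG : G ∈ regularFinset V d) :
    switch G a u b v ∈ regularFinset V d := by
  rw [mem_regularFinset] at *
  intro x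
  rw [h.card_neighbors, hG]

/-- Double counting of switchings between two families of graphs. -/
theorem card_mul_le_card_mul_of_switch (𝒜 ℬ : Finset (SimpleGraph V))
    (R R' : SimpleGraph V → V × V × V × V → Prop) (m r : ℕ)
    (hR : ∀ G ∈ 𝒜, ∀ q, R G q → IsSwitchable G q.1 q.2.1 q.2.2.1 q.2.2.2)
    (hmaps : ∀ G ∈ 𝒜, ∀ q, R G q → switch G q.1 q.2.1 q.2.2.1 q.2.2.2 ∈ ℬ)
    (hR' : ∀ G ∈ 𝒜, ∀ q, R G q → R' (switch G q.1 q.2.1 q.2.2.1 q.2.2.2) q)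
    (hm : ∀ G ∈ 𝒜, m ≤ #{q | R G q}) (hr : ∀ G ∈ ℬ, #{q | R' G q} ≤ r) :
    #𝒜 * m ≤ #ℬ * r := by
  calc #𝒜 * m ≤ ∑ G ∈ 𝒜, #{q | R G q} := by
        simpa using card_nsmul_le_sum 𝒜 (fun G => #{q | R G q}) m hm
    _ = #(𝒜.sigma fun G => ({q | R G q} : Finset (V × V × V × V))) := (card_sigma _ _).symm
    _ ≤ #(ℬ.sigma fun G => ({q | R' G q} : Finset (V × V × V × V))) := by
        refine card_le_card_of_injOn
          (fun p => ⟨switch p.1 p.2.1 p.2.2.1 p.2.2.2.1 p.2.2.2.2, p.2⟩) ?_ ?_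
        · rintro ⟨G, q⟩ h
          simp only [coe_sigma, Set.mem_sigma_iff, mem_coe, mem_filter, mem_univ, true_and] at h ⊢
          exact ⟨hmaps G h.1 q h.2, hR' G h.1 q h.2⟩
        · rintro ⟨G, q⟩ h ⟨G', q'⟩ h' heq
          simp only [coe_sigma, Set.mem_sigma_iff, mem_coe, mem_filter, mem_univ, true_and] at h h'
          simp only [Sigma.mk.injEq, heq_eq_eq] at heq
          obtain ⟨h1, rfl⟩ := heq
          -- The quadruple is kept in the image, and reversing the switching recovers the graph:
          -- this is the injectivity.
          have e := (hR G h.1 q h.2).switch_switch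
          have e' := (hR G' h'.1 q h'.2).switch_switch
          rw [h1, e'] at e
          rw [e]
    _ = ∑ G ∈ ℬ, #{q | R' G q} := card_sigma _ _
    _ ≤ #ℬ * r := by simpa using sum_le_card_nsmul ℬ (fun G => #{q | R' G q}) r hr

end

/-! ### Probability of containing prescribed edges. -/

section

variable {V : Type*} [Fintype V]

theorem card_adj_fst {G : SimpleGraph V} {d : ℕ} (hG : G ∈ regularFinset V d) (s : Finset V) :
    #{p : V × V | p.1 ∈ s ∧ G.Adj p.1 p.2} = #s * d := by
  rw [mem_regularFinset] at hG
  simp only [card_filter] at hG ⊢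
  rw [Fintype.sum_prod_type]
  have h (x : V) : (∑ y, if x ∈ s then if G.Adj x y then 1 else 0 else 0)
      = if x ∈ s then d else 0 := by
    split_ifs <;> simp_all
  simp [ite_and, h]

theorem card_adj_snd {G : SimpleGraph V} {d : ℕ} (hG : G ∈ regularFinset V d) (s : Finset V) :
    #{p : V × V | p.2 ∈ s ∧ G.Adj p.1 p.2} = #s * d := by
  rw [← card_adj_fst hG s]
  refine card_bij (fun p _ => (p.2, p.1)) ?_ ?_ ?_
  · simp +contextual [G.adj_comm]
  · simp +contextual [Prod.ext_iff]
  · rintro ⟨x, y⟩ h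
    exact ⟨(y, x), by simpa [G.adj_comm] using h, rfl⟩

theorem card_adj {G : SimpleGraph V} {d : ℕ} (hG : G ∈ regularFinset V d) :
    #{p : V × V | G.Adj p.1 p.2} = Fintype.card V * d := by
  simpa using card_adj_fst hG univ

theorem card_closed_neighbors_le {G : SimpleGraph V} {d : ℕ} (hG : G ∈ regularFinset V d) (a : V) :
    #{x | x = a ∨ G.Adj a x} ≤ d + 1 := by
  rw [mem_regularFinset] at hG
  rw [filter_or, ← hG a, add_comm]
  refine (card_union_le _ _).trans (Nat.add_le_add_right ?_ _)
  exact card_le_one.2 (by simp +contextual)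

theorem card_pairs_mem_le (F : Finset (Sym2 V)) : #{p : V × V | s(p.1, p.2) ∈ F} ≤ 2 * #F := by
  refine card_le_mul_card_image_of_maps_to (f := fun p : V × V => s(p.1, p.2))
    (by simp) 2 ?_
  intro e _
  induction e with | _ x y =>
  refine (card_le_card (t := {(x, y), (y, x)}) ?_).trans card_le_two
  rintro ⟨p, q⟩ h
  simp only [mem_filter, mem_univ, true_and, Sym2.eq_iff, mem_insert, mem_singleton,
    Prod.mk.injEq] at h ⊢
  exact h.2

/-- Switch `au` away using an oriented edge `bv` outside `F`. Of the `n * d` oriented edges, at most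
`2 * #F` lie in `F`, and at most `(d + 1) * d` are lost on each side because `b` is `a` or adjacent
to it, or `v` is `u` or adjacent to it. In reverse, `b` and `v` are neighbours of `a` and `u` in the
new graph, which leaves `d * d` choices. -/
theorem card_containing_insert_mul_le (d : ℕ) (F : Finset (Sym2 V)) (a u : V) (h : s(a, u) ∉ F) :
    #{G ∈ regularFinset V d | ∀ e ∈ insert s(a, u) F, e ∈ G.edgeSet} *
        (Fintype.card V * d - (2 * #F + 2 * (d + 1) * d))
      ≤ #{G ∈ regularFinset V d | ∀ e ∈ F, e ∈ G.edgeSet} * (d * d) := by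
  refine card_mul_le_card_mul_of_switch _ _
    (fun G q => IsSwitchable G q.1 q.2.1 q.2.2.1 q.2.2.2 ∧ q.1 = a ∧ q.2.1 = u ∧
      s(q.2.2.1, q.2.2.2) ∉ F)
    (fun G q => q.1 = a ∧ q.2.1 = u ∧ G.Adj a q.2.2.1 ∧ G.Adj u q.2.2.2) _ _ ?_ ?_ ?_ ?_ ?_
  · intro G _ q hq
    exact hq.1
  · rintro G hG ⟨a', u', b, v⟩ ⟨hs, rfl, rfl, hF⟩
    simp only [mem_filter] at hG ⊢
    refine ⟨hs.switch_mem hG.1, fun e he => ?_⟩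
    have hne : e ≠ s(a', u') := by rintro rfl; exact h he
    have hne' : e ≠ s(b, v) := by rintro rfl; exact hF he
    have hmem := hG.2 e (mem_insert_of_mem he)
    induction e with | _ x y =>
    rw [SimpleGraph.mem_edgeSet] at *
    rw [switch_adj]
    exact ⟨Or.inl ⟨hmem, hne, hne'⟩, hmem.ne⟩
  · rintro G hG ⟨a', u', b, v⟩ ⟨hs, rfl, rfl, hF⟩
    refine ⟨rfl, rfl, ?_, ?_⟩
    · rw [switch_adj]; exact ⟨Or.inr (Or.inl rfl), hs.ne_left⟩
    · rw [switch_adj]; exact ⟨Or.inr (Or.inr rfl), hs.ne_right⟩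
  · intro G hG
    simp only [mem_filter] at hG
    have hau : G.Adj a u := hG.2 _ (mem_insert_self _ _)
    have hG := hG.1
    have hsub : ({p : V × V | G.Adj p.1 p.2} : Finset (V × V)) ⊆
        ({p : V × V | IsSwitchable G a u p.1 p.2 ∧ s(p.1, p.2) ∉ F} : Finset (V × V)) ∪
        ((({p : V × V | s(p.1, p.2) ∈ F} : Finset (V × V)) ∪
          ({p : V × V | p.1 ∈ ({x | x = a ∨ G.Adj a x} : Finset V) ∧ G.Adj p.1 p.2}
            : Finset (V × V))) ∪
          ({p : V × V | p.2 ∈ ({x | x = u ∨ G.Adj u x} : Finset V) ∧ G.Adj p.1 p.2}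
            : Finset (V × V))) := by
      rintro ⟨b, v⟩ hbv
      simp only [mem_filter, mem_univ, true_and, mem_union] at hbv ⊢
      by_contra hcon
      push Not at hcon
      obtain ⟨h1, ⟨h2, h3⟩, h4⟩ := hcon
      refine h2 (h1 ⟨hau, hbv, ?_, ?_, ?_, ?_⟩)
      · exact fun t => h3 (Or.inr t) hbv
      · exact fun t => h4 (Or.inr t) hbv
      · exact fun t => h3 (Or.inl t.symm) hbv
      · exact fun t => h4 (Or.inl t.symm) hbv
    have hc := (card_le_card hsub).trans ((card_union_le _ _).trans
      (Nat.add_le_add_left ((card_union_le _ _).trans (Nat.add_le_add_right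
        (card_union_le _ _) _)) _))
    rw [card_adj hG, card_adj_fst hG, card_adj_snd hG] at hc
    have e1 := Nat.mul_le_mul_right d (card_closed_neighbors_le hG a)
    have e2 := Nat.mul_le_mul_right d (card_closed_neighbors_le hG u)
    have e3 := card_pairs_mem_le F
    have e4 : #{p : V × V | IsSwitchable G a u p.1 p.2 ∧ s(p.1, p.2) ∉ F} ≤
        #{q : V × V × V × V | IsSwitchable G q.1 q.2.1 q.2.2.1 q.2.2.2 ∧ q.1 = a ∧ q.2.1 = u ∧
          s(q.2.2.1, q.2.2.2) ∉ F} := by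
      refine card_le_card_of_injOn (fun p => (a, u, p.1, p.2)) ?_ ?_
      · intro p hp
        simpa using hp
      · intro p _ p' _ hpp
        simpa [Prod.ext_iff] using hpp
    have e5 : 2 * (d + 1) * d = (d + 1) * d + (d + 1) * d := by ring
    refine le_trans ?_ (e4.trans_eq (by congr!))
    omega
  · intro G hG
    simp only [mem_filter] at hG
    have hG := mem_regularFinset.1 hG.1
    nth_rewrite 2 [← hG u]
    rw [← hG a, ← card_product]
    refine card_le_card_of_injOn (fun q => (q.2.2.1, q.2.2.2)) ?_ ?_
    · intro q hq
      simp only [coe_filter, mem_univ, true_and, Set.mem_ofPred_eq] at hq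
      simp [hq.2.2]
    · rintro ⟨a1, u1, b1, v1⟩ h1 ⟨a2, u2, b2, v2⟩ h2 heq
      simp only [coe_filter, mem_univ, true_and, Set.mem_ofPred_eq] at h1 h2
      simp only [Prod.mk.injEq] at heq ⊢
      exact ⟨h1.1.trans h2.1.symm, h1.2.1.trans h2.2.1.symm, heq.1, heq.2⟩

/-- A given set of `m` edges is contained in at most a fraction `(4 * d / n) ^ m` of the
`d`-regular graphs. -/
theorem card_containing_mul_le {d : ℕ} (hd : 0 < d) (hn : 8 * (d + 1) ≤ Fintype.card V)
    (F : Finset (Sym2 V)) (hF : 4 * #F ≤ Fintype.card V * d) :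
    #{G ∈ regularFinset V d | ∀ e ∈ F, e ∈ G.edgeSet} * Fintype.card V ^ #F ≤
      (4 * d) ^ #F * #(regularFinset V d) := by
  induction F using Finset.induction_on with
  | empty => simp
  | insert e F he ih =>
    rw [card_insert_of_notMem he] at hF ⊢
    specialize ih (by omega)
    induction e with | _ a u =>
    have h := card_containing_insert_mul_le d F a u he
    set N := Fintype.card V
    set X := #{G ∈ regularFinset V d | ∀ e ∈ insert s(a, u) F, e ∈ G.edgeSet}
    set Y := #{G ∈ regularFinset V d | ∀ e ∈ F, e ∈ G.edgeSet}
    -- The excluded oriented edges number at most `N * d / 2` for `F` and `N * d / 4` for the closed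
    -- neighbourhoods, so a quarter remains.
    have h1 : N * d ≤ 4 * (N * d - (2 * #F + 2 * (d + 1) * d)) := by
      have : 8 * (d + 1) * d ≤ N * d := Nat.mul_le_mul_right d hn
      have e1 : 8 * (d + 1) * d = 8 * ((d + 1) * d) := by ring
      have e2 : 2 * (d + 1) * d = 2 * ((d + 1) * d) := by ring
      omega
    have h2 : X * N ≤ 4 * d * Y := by
      have : X * N * d ≤ 4 * d * Y * d := by
        calc X * N * d = X * (N * d) := by ring
          _ ≤ X * (4 * (N * d - (2 * #F + 2 * (d + 1) * d))) := Nat.mul_le_mul_left _ h1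
          _ = 4 * (X * (N * d - (2 * #F + 2 * (d + 1) * d))) := by ring
          _ ≤ 4 * (Y * (d * d)) := Nat.mul_le_mul_left _ h
          _ = 4 * d * Y * d := by ring
      exact Nat.le_of_mul_le_mul_right this hd
    calc X * N ^ (#F + 1) = X * N * N ^ #F := by ring
      _ ≤ 4 * d * Y * N ^ #F := Nat.mul_le_mul_right _ h2
      _ = 4 * d * (Y * N ^ #F) := by ring
      _ ≤ 4 * d * ((4 * d) ^ #F * #(regularFinset V d)) := Nat.mul_le_mul_left _ ih
      _ = _ := by ring

end

/-! ### Edges between two large sets. -/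

section

variable {V : Type*} [Fintype V]

/-- The number of edges between two sets of vertices. -/
noncomputable def crossCard (G : SimpleGraph V) (A B : Finset V) : ℕ :=
  #{p : V × V | p.1 ∈ A ∧ p.2 ∈ B ∧ G.Adj p.1 p.2}

/-- Bounds the quadruples that cannot be switched because `ab` is already an edge. -/
theorem card_cross_neighbors_le {G : SimpleGraph V} {d : ℕ} (hG : G ∈ regularFinset V d)
    (A B : Finset V) :
    #{q : V × V × V × V | (q.1 ∈ A ∧ q.2.2.1 ∈ B ∧ G.Adj q.1 q.2.2.1) ∧
      G.Adj q.1 q.2.1 ∧ G.Adj q.2.2.1 q.2.2.2} ≤ d * d * crossCard G A B := by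
  rw [mem_regularFinset] at hG
  refine card_le_mul_card_image_of_maps_to (f := fun q => (q.1, q.2.2.1)) ?_ _ ?_
  · rintro q hq
    simp only [mem_filter, mem_univ, true_and] at hq ⊢
    exact hq.1
  · rintro ⟨a, b⟩ _
    nth_rewrite 1 [← hG a]
    rw [← hG b, ← card_product]
    refine card_le_card_of_injOn (fun q => (q.2.1, q.2.2.2)) ?_ ?_
    · rintro ⟨a', u, b', v⟩ hq
      simp only [coe_filter, mem_filter, mem_univ, true_and, Set.mem_ofPred_eq,
        Prod.mk.injEq] at hq
      obtain ⟨⟨_, h1, h2⟩, rfl, rfl⟩ := hq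
      simp [h1, h2]
    · rintro ⟨a1, u1, b1, v1⟩ h1 ⟨a2, u2, b2, v2⟩ h2 heq
      simp only [coe_filter, mem_filter, mem_univ, true_and, Set.mem_ofPred_eq,
        Prod.mk.injEq] at h1 h2 heq ⊢
      exact ⟨h1.2.1.trans h2.2.1.symm, heq.1, h1.2.2.trans h2.2.2.symm, heq.2⟩

/-- Bounds the quadruples that cannot be switched because `u = v` or `uv` is already an edge. -/
theorem card_short_walks_le {G : SimpleGraph V} {d : ℕ} (hG : G ∈ regularFinset V d) :
    #{q : V × V × V × V | G.Adj q.1 q.2.1 ∧ (q.2.2.2 = q.2.1 ∨ G.Adj q.2.1 q.2.2.2) ∧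
      G.Adj q.2.2.1 q.2.2.2} ≤ (d + 1) * d * (Fintype.card V * d) := by
  rw [← card_adj hG]
  refine card_le_mul_card_image_of_maps_to (f := fun q => (q.1, q.2.1)) ?_ _ ?_
  · rintro q hq
    simp only [mem_filter, mem_univ, true_and] at hq ⊢
    exact hq.1
  · rintro ⟨a, u⟩ _
    refine le_trans ?_ ((card_adj_snd hG _).trans_le
      (Nat.mul_le_mul_right d (card_closed_neighbors_le hG u)))
    refine card_le_card_of_injOn (fun q => (q.2.2.1, q.2.2.2)) ?_ ?_
    · rintro ⟨a', u', b, v⟩ hq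
      simp only [coe_filter, mem_filter, mem_univ, true_and, Set.mem_ofPred_eq,
        Prod.mk.injEq] at hq ⊢
      obtain ⟨⟨_, h1, h2⟩, rfl, rfl⟩ := hq
      exact ⟨h1, h2⟩
    · rintro ⟨a1, u1, b1, v1⟩ h1 ⟨a2, u2, b2, v2⟩ h2 heq
      simp only [coe_filter, mem_filter, mem_univ, true_and, Set.mem_ofPred_eq,
        Prod.mk.injEq] at h1 h2 heq ⊢
      exact ⟨h1.2.1.trans h2.2.1.symm, h1.2.2.trans h2.2.2.symm, heq.1, heq.2⟩

theorem le_card_adj_notMem {G : SimpleGraph V} {d : ℕ} (hG : G ∈ regularFinset V d)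
    (A B : Finset V) :
    #A * d - crossCard G A B ≤ #{p : V × V | p.1 ∈ A ∧ p.2 ∉ B ∧ G.Adj p.1 p.2} := by
  rw [← card_adj_fst hG, Nat.sub_le_iff_le_add]
  refine (card_le_card ?_).trans (card_union_le _ _)
  intro p
  simp only [mem_filter, mem_univ, true_and, mem_union]
  tauto

theorem crossCard_comm (G : SimpleGraph V) (A B : Finset V) :
    crossCard G A B = crossCard G B A := by
  refine card_bij (fun p _ => (p.2, p.1)) ?_ ?_ ?_
  · simp +contextual [G.adj_comm]
  · simp +contextual [Prod.ext_iff]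
  · rintro ⟨x, y⟩ h
    simp only [mem_filter, mem_univ, true_and] at h
    exact ⟨(y, x), by simpa using ⟨h.2.1, h.1, h.2.2.symm⟩, rfl⟩

/-- Only the new edges `ab` and `uv` can add to the count; the latter does so when `u ∈ A` and `v ∈
B`, hence `2` and not `1`. -/
theorem crossCard_switch_le (G : SimpleGraph V) {A B : Finset V} (h : Disjoint A B)
    {a u b v : V} (ha : a ∈ A) (hb : b ∈ B) (hu : u ∉ B) :
    crossCard (switch G a u b v) A B ≤ crossCard G A B + 2 := by
  have hsub : ({p : V × V | p.1 ∈ A ∧ p.2 ∈ B ∧ (switch G a u b v).Adj p.1 p.2}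
      : Finset (V × V)) ⊆
      ({p : V × V | p.1 ∈ A ∧ p.2 ∈ B ∧ G.Adj p.1 p.2} : Finset (V × V)) ∪ {(a, b), (u, v)} := by
    have hd := fun x (hx : x ∈ A) => disjoint_left.1 h hx
    rintro ⟨x, y⟩ hp
    simp only [mem_filter, mem_univ, true_and, mem_union, mem_insert, mem_singleton, switch_adj,
      Sym2.eq_iff, Prod.mk.injEq] at hp ⊢
    obtain ⟨h1, h2, (h3 | (⟨rfl, rfl⟩ | ⟨rfl, rfl⟩) | (⟨rfl, rfl⟩ | ⟨rfl, rfl⟩)), -⟩ := hp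
    · exact Or.inl ⟨h1, h2, h3.1⟩
    · simp
    · exact absurd hb (hd _ h1)
    · simp
    · exact absurd h2 hu
  exact (card_le_card hsub).trans ((card_union_le _ _).trans (Nat.add_le_add_left card_le_two _))

/-- Switch an edge leaving `A` with an edge leaving `B`, so that `ab` becomes a cross edge. In
reverse, `ab` is one of at most `k + 2` cross edges and `uv` one of the `n * d` oriented edges. -/
theorem card_crossCard_le_mul_le (d k : ℕ) {A B : Finset V} (h : Disjoint A B) :
    #{G ∈ regularFinset V d | crossCard G A B ≤ k} *
        ((#A * d - k) * (#B * d - k) - (d * d * k + (d + 1) * d * (Fintype.card V * d)))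
      ≤ #{G ∈ regularFinset V d | crossCard G A B ≤ k + 2} *
        ((k + 2) * (Fintype.card V * d)) := by
  refine card_mul_le_card_mul_of_switch _ _
    (fun G q => (q.1 ∈ A ∧ q.2.1 ∉ B ∧ q.2.2.1 ∈ B ∧ q.2.2.2 ∉ A) ∧
      IsSwitchable G q.1 q.2.1 q.2.2.1 q.2.2.2)
    (fun G q => (q.1 ∈ A ∧ q.2.2.1 ∈ B ∧ G.Adj q.1 q.2.2.1) ∧ G.Adj q.2.1 q.2.2.2)
    _ _ ?_ ?_ ?_ ?_ ?_
  · intro G _ q hq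
    exact hq.2
  · rintro G hG ⟨a, u, b, v⟩ ⟨⟨ha, hu, hb, hv⟩, hs⟩
    simp only [mem_filter] at hG ⊢
    exact ⟨hs.switch_mem hG.1,
      (crossCard_switch_le G h ha hb hu).trans (Nat.add_le_add_right hG.2 2)⟩
  · rintro G hG ⟨a, u, b, v⟩ ⟨⟨ha, hu, hb, hv⟩, hs⟩
    refine ⟨⟨ha, hb, ?_⟩, ?_⟩
    · rw [switch_adj]; exact ⟨Or.inr (Or.inl rfl), hs.ne_left⟩
    · rw [switch_adj]; exact ⟨Or.inr (Or.inr rfl), hs.ne_right⟩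
  · intro G hG
    simp only [mem_filter] at hG
    obtain ⟨hG, hk⟩ := hG
    have e1 := le_card_adj_notMem hG A B
    have e2 := le_card_adj_notMem hG B A
    rw [crossCard_comm] at e2
    have e3 := Nat.mul_le_mul ((Nat.sub_le_sub_left hk _).trans e1)
      ((Nat.sub_le_sub_left hk _).trans e2)
    rw [← card_product] at e3
    rw [Nat.sub_le_iff_le_add]
    refine e3.trans ?_
    refine le_trans ?_ (Nat.add_le_add_left (Nat.add_le_add
      ((card_cross_neighbors_le hG A B).trans (Nat.mul_le_mul_left _ hk))
      (card_short_walks_le hG)) _)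
    refine le_trans ?_ ((card_union_le _ _).trans (Nat.add_le_add_left (card_union_le _ _) _))
    refine card_le_card_of_injOn (fun p => (p.1.1, p.1.2, p.2.1, p.2.2)) ?_ ?_
    · rintro ⟨⟨a, u⟩, ⟨b, v⟩⟩ hp
      simp only [coe_product, Set.mem_prod, mem_coe, mem_filter, mem_univ, true_and,
        mem_union] at hp ⊢
      obtain ⟨⟨ha, hu, hau⟩, hb, hv, hbv⟩ := hp
      by_cases h1 : G.Adj a b
      · exact Or.inr (Or.inl ⟨⟨ha, hb, h1⟩, hau, hbv⟩)
      by_cases h2 : v = u ∨ G.Adj u v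
      · exact Or.inr (Or.inr ⟨hau, h2, hbv⟩)
      push Not at h2
      exact Or.inl ⟨⟨ha, hu, hb, hv⟩, hau, hbv, h1, h2.2,
        fun t => disjoint_left.1 h ha (t ▸ hb), h2.1.symm⟩
    · rintro ⟨⟨a, u⟩, ⟨b, v⟩⟩ _ ⟨⟨a', u'⟩, ⟨b', v'⟩⟩ _ heq
      simpa [and_assoc] using heq
  · intro G hG
    simp only [mem_filter] at hG
    obtain ⟨hG, hk⟩ := hG
    rw [← card_adj hG]
    refine le_trans ?_ (Nat.mul_le_mul_right _ hk)
    rw [crossCard, ← card_product]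
    refine card_le_card_of_injOn (fun q => ((q.1, q.2.2.1), (q.2.1, q.2.2.2))) ?_ ?_
    · rintro ⟨a, u, b, v⟩ hq
      simpa using hq
    · rintro ⟨a1, u1, b1, v1⟩ h1 ⟨a2, u2, b2, v2⟩ h2 heq
      simp only [Prod.mk.injEq] at heq ⊢
      tauto

/-- With `s = δ * n * d`, there are at least `(9 / 16 - 3 / 8) * s ^ 2 ≥ s ^ 2 / 8` forward
switchings, against at most `s ^ 2 / 64` reverse ones. -/
theorem card_crossCard_le_mul_eight_le {d k : ℕ} {δ : ℝ} (hδ : 0 < δ) (hδ1 : δ ≤ 1)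
    (hd : 0 < d) (hn : 6 * d ≤ δ ^ 2 * Fintype.card V)
    {A B : Finset V} (h : Disjoint A B)
    (hA : δ * Fintype.card V ≤ #A) (hB : δ * Fintype.card V ≤ #B)
    (hk : 64 * (k + 2 : ℝ) ≤ δ ^ 2 * Fintype.card V * d) :
    #{G ∈ regularFinset V d | crossCard G A B ≤ k} * 8
      ≤ #{G ∈ regularFinset V d | crossCard G A B ≤ k + 2} := by
  have key := card_crossCard_le_mul_le d k h
  set n := Fintype.card V
  have hd1 : (1 : ℝ) ≤ d := by exact_mod_cast hd
  have hn0 : (0 : ℝ) < n := by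
    by_contra hcon
    have : δ ^ 2 * n ≤ 0 := mul_nonpos_of_nonneg_of_nonpos (by positivity) (by linarith)
    linarith
  have hn0' : 0 < n := by exact_mod_cast hn0
  set s : ℝ := δ * n * d with hs
  have hs0 : 0 < s := by positivity
  have hsle : δ ^ 2 * n * d ≤ s := by
    have : δ * s ≤ 1 * s := mul_le_mul_of_nonneg_right hδ1 hs0.le
    calc δ ^ 2 * n * d = δ * s := by rw [hs]; ring
      _ ≤ s := by linarith
  have hk0 : (0 : ℝ) ≤ k := by positivity
  have hAk : 3 / 4 * s ≤ #A * d - k := by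
    have := mul_le_mul_of_nonneg_right hA (by positivity : (0 : ℝ) ≤ d)
    linarith
  have hBk : 3 / 4 * s ≤ #B * d - k := by
    have := mul_le_mul_of_nonneg_right hB (by positivity : (0 : ℝ) ≤ d)
    linarith
  have hprod : 9 / 16 * s ^ 2 ≤ (#A * d - k) * (#B * d - k) := by
    calc 9 / 16 * s ^ 2 = (3 / 4 * s) * (3 / 4 * s) := by ring
      _ ≤ _ := mul_le_mul hAk hBk (by positivity) (by linarith)
  have hs2 : 6 * d * (n * d * d) ≤ s ^ 2 := by
    calc 6 * d * (n * d * d) ≤ δ ^ 2 * n * (n * d * d) :=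
          mul_le_mul_of_nonneg_right hn (by positivity)
      _ = s ^ 2 := by rw [hs]; ring
  have hkn : (k : ℝ) ≤ n * d / 64 := by
    have : δ ^ 2 * n * d ≤ 1 * (n * d) := by
      rw [mul_assoc]
      exact mul_le_mul_of_nonneg_right (pow_le_one₀ hδ.le hδ1) (by positivity)
    linarith
  have hbad : (d * d * k + (d + 1) * d * (n * d) : ℝ) ≤ 3 / 8 * s ^ 2 := by
    have h1 : (d * d * k : ℝ) ≤ d * d * (n * d / 64) :=
      mul_le_mul_of_nonneg_left hkn (by positivity)
    have h2 : ((d + 1) * d * (n * d) : ℝ) ≤ (d + d) * d * (n * d) := by gcongr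
    nlinarith
  have hrev : 8 * ((k + 2) * (n * d) : ℝ) ≤ 1 / 8 * s ^ 2 := by
    have : 64 * (k + 2 : ℝ) * (n * d) ≤ δ ^ 2 * n * d * (n * d) :=
      mul_le_mul_of_nonneg_right hk (by positivity)
    have e : δ ^ 2 * n * d * (n * d) = s ^ 2 := by rw [hs]; ring
    linarith
  have hA' : k ≤ #A * d := by
    have : (k : ℝ) ≤ #A * d := by linarith
    exact_mod_cast this
  have hB' : k ≤ #B * d := by
    have : (k : ℝ) ≤ #B * d := by linarith
    exact_mod_cast this
  have hmain : 8 * ((k + 2) * (n * d)) ≤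
      (#A * d - k) * (#B * d - k) - (d * d * k + (d + 1) * d * (n * d)) := by
    refine Nat.le_sub_of_add_le ?_
    rw [← Nat.cast_le (α := ℝ)]
    push_cast [Nat.cast_sub hA', Nat.cast_sub hB']
    nlinarith [sq_nonneg s]
  have hpos : 0 < (k + 2) * (n * d) := by positivity
  refine Nat.le_of_mul_le_mul_right ?_ hpos
  refine le_trans ?_ key
  rw [mul_assoc]
  exact Nat.mul_le_mul_left _ hmain

/-- Two given disjoint sets of linear size are seldom without an edge between them. -/
theorem card_crossCard_eq_zero_mul_le {d : ℕ} {δ : ℝ} (hδ : 0 < δ) (hδ1 : δ ≤ 1)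
    (hd : 128 ≤ δ ^ 2 * d) (hn : 6 * d ≤ δ ^ 2 * Fintype.card V)
    {A B : Finset V} (h : Disjoint A B)
    (hA : δ * Fintype.card V ≤ #A) (hB : δ * Fintype.card V ≤ #B) :
    #{G ∈ regularFinset V d | crossCard G A B = 0} * 8 ^ Fintype.card V
      ≤ #(regularFinset V d) := by
  have hd0 : 0 < d := by
    rcases Nat.eq_zero_or_pos d with rfl | h0
    · norm_num at hd
    · exact h0
  -- The bound on the number of cross edges rises by `2` in each of `n` rounds, gaining a factor `8`
  -- each time; `128 ≤ δ ^ 2 * d` keeps it admissible up to `2 * n`.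
  have key : ∀ j ≤ Fintype.card V, #{G ∈ regularFinset V d | crossCard G A B = 0} * 8 ^ j ≤
      #{G ∈ regularFinset V d | crossCard G A B ≤ 2 * j} := by
    intro j
    induction j with
    | zero => simp
    | succ j ih =>
      intro hj
      rw [pow_succ, ← mul_assoc]
      refine (Nat.mul_le_mul_right 8 (ih (by omega))).trans ?_
      refine card_crossCard_le_mul_eight_le (k := 2 * j) hδ hδ1 hd0 hn h hA hB ?_
      have hj' : ((j + 1 : ℕ) : ℝ) ≤ Fintype.card V := by exact_mod_cast hj
      push_cast at hj' ⊢
      have : (128 : ℝ) * Fintype.card V ≤ δ ^ 2 * d * Fintype.card V :=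
        mul_le_mul_of_nonneg_right hd (by positivity)
      linarith
  exact (key _ le_rfl).trans (card_le_card (filter_subset _ _))

end

/-! ### Union bounds for the two expansion properties. -/

section

theorem choose_le_three_mul_div_pow (N m : ℕ) (hm : 0 < m) :
    (N.choose m : ℝ) ≤ (3 * N / m) ^ m := by
  have h1 : (N.choose m : ℝ) ≤ (N : ℝ) ^ m / m.factorial := Nat.choose_le_pow_div m N
  have h2 : (m : ℝ) ^ m / m.factorial ≤ Real.exp m :=
    Real.pow_div_factorial_le_exp _ (by positivity) m
  have h3 : Real.exp m ≤ 3 ^ m := by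
    rw [← Real.exp_one_pow]
    exact pow_le_pow_left₀ (Real.exp_pos _).le Real.exp_one_lt_three.le m
  have hm0 : (0 : ℝ) < m := by exact_mod_cast hm
  calc (N.choose m : ℝ) ≤ (N : ℝ) ^ m / m.factorial := h1
    _ = (N / m : ℝ) ^ m * ((m : ℝ) ^ m / m.factorial) := by
        rw [div_pow]; field_simp
    _ ≤ (N / m : ℝ) ^ m * 3 ^ m := by gcongr; exact h2.trans h3
    _ = (3 * N / m) ^ m := by rw [← mul_pow]; ring

theorem sum_range_div_two_pow_le (M : ℕ) :
    ∑ t ∈ range (M + 1), (t : ℝ) / 2 ^ t = 2 - (M + 2) / 2 ^ M := by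
  induction M with
  | zero => simp
  | succ M ih =>
    rw [sum_range_succ, ih]
    push_cast
    field_simp
    ring

/-- The expected number of dense sets of size `t`. As `r ≥ 2`, the edge factor is at most `(96 * t /
n) ^ (2 * t)`, which outweighs the `(3 * n / t) ^ t` choices of the set. The product is `(27648 * t
/ n) ^ t`, and `55296 = 2 * 27648` leaves a summable `2 ^ (-t)` while one factor `1 / n` survives.
-/
theorem choose_mul_choose_mul_pow_le {n t r d : ℕ} (ht : 0 < t) (htn : 55296 * t ≤ n)
    (hr : 2 ≤ r) (hd : d ≤ 8 * r) :
    (n.choose t : ℝ) * ((t ^ 2).choose (r * t) * (4 * d / n : ℝ) ^ (r * t)) ≤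
      55296 / n * (t / 2 ^ t) := by
  have ht0 : (0 : ℝ) < t := by exact_mod_cast ht
  have hn0 : (0 : ℝ) < n := by exact_mod_cast (by omega : 0 < n)
  have hr0 : (0 : ℝ) < r := by exact_mod_cast (by omega : 0 < r)
  have hd' : (d : ℝ) ≤ 8 * r := by exact_mod_cast hd
  have htn' : 55296 * (t : ℝ) / n ≤ 1 := by
    rw [div_le_one hn0]; exact_mod_cast htn
  have h1 := choose_le_three_mul_div_pow n t ht
  have h2 := choose_le_three_mul_div_pow (t ^ 2) (r * t) (by positivity)
  have h3 : ((t ^ 2).choose (r * t) : ℝ) * (4 * d / n : ℝ) ^ (r * t) ≤ ((96 * t / n) ^ 2) ^ t := by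
    calc ((t ^ 2).choose (r * t) : ℝ) * (4 * d / n : ℝ) ^ (r * t)
        ≤ (3 * (t ^ 2 : ℕ) / (r * t : ℕ)) ^ (r * t) * (4 * d / n : ℝ) ^ (r * t) := by gcongr
      _ = (12 * t / n * (d / r) : ℝ) ^ (r * t) := by
          rw [← mul_pow]; push_cast; congr 1; field_simp; ring
      _ ≤ (12 * t / n * 8 : ℝ) ^ (r * t) := by
          gcongr
          rwa [div_le_iff₀ hr0]
      _ = (96 * t / n : ℝ) ^ (r * t) := by congr 1; ring
      _ ≤ (96 * t / n : ℝ) ^ (2 * t) := by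
          refine pow_le_pow_of_le_one (by positivity) (le_trans ?_ htn')
            (Nat.mul_le_mul_right t hr)
          gcongr
          norm_num
      _ = _ := pow_mul _ _ _
  calc (n.choose t : ℝ) * ((t ^ 2).choose (r * t) * (4 * d / n : ℝ) ^ (r * t))
      ≤ (3 * n / t) ^ t * ((96 * t / n) ^ 2) ^ t := by gcongr
    _ = (55296 * t / n : ℝ) ^ t / 2 ^ t := by
        rw [← mul_pow, ← div_pow]; congr 1; field_simp; norm_num
    _ ≤ (55296 * t / n : ℝ) / 2 ^ t := by
        gcongr
        exact pow_le_of_le_one (by positivity) htn' (by omega)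
    _ = _ := by ring

variable {V : Type*} [Fintype V]

/-- Two disjoint sets of at least `δ * n` vertices each have no edge between them. -/
def HasUnjoinedPair (G : SimpleGraph V) (δ : ℝ) : Prop :=
  ∃ A B : Finset V, Disjoint A B ∧ δ * Fintype.card V ≤ #A ∧ δ * Fintype.card V ≤ #B ∧
    crossCard G A B = 0

theorem card_hasUnjoinedPair_mul_le {d : ℕ} {δ : ℝ} (hδ : 0 < δ) (hδ1 : δ ≤ 1)
    (hd : 128 ≤ δ ^ 2 * d) (hn : 6 * d ≤ δ ^ 2 * Fintype.card V) :
    #{G ∈ regularFinset V d | HasUnjoinedPair G δ} * 2 ^ Fintype.card V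
      ≤ #(regularFinset V d) := by
  set n := Fintype.card V with hn'
  let P : Finset (Finset V × Finset V) :=
    {p | Disjoint p.1 p.2 ∧ δ * n ≤ #p.1 ∧ δ * n ≤ #p.2}
  have hP : #P ≤ 2 ^ n * 2 ^ n := by
    refine (card_le_univ _).trans ?_
    simp [hn']
  have hsub : ({G ∈ regularFinset V d | HasUnjoinedPair G δ} : Finset (SimpleGraph V)) ⊆
      P.biUnion fun p => {G ∈ regularFinset V d | crossCard G p.1 p.2 = 0} := by
    intro G hG
    simp only [mem_filter, mem_biUnion] at hG ⊢
    obtain ⟨hG, A, B, h1, h2, h3, h4⟩ := hG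
    exact ⟨(A, B), by simpa [P, h1] using ⟨h2, h3⟩, hG, h4⟩
  -- There are at most `4 ^ n` pairs, each of probability at most `8 ^ (-n)`.
  have h8 : (0 : ℕ) < 2 ^ n * 2 ^ n := by positivity
  refine Nat.le_of_mul_le_mul_right ?_ h8
  calc _ = #{G ∈ regularFinset V d | HasUnjoinedPair G δ} * 8 ^ n := by
        rw [mul_assoc, ← mul_pow, ← mul_pow]; norm_num
    _ ≤ (∑ p ∈ P, #{G ∈ regularFinset V d | crossCard G p.1 p.2 = 0}) * 8 ^ n :=
        Nat.mul_le_mul_right _ ((card_le_card hsub).trans card_biUnion_le)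
    _ = ∑ p ∈ P, #{G ∈ regularFinset V d | crossCard G p.1 p.2 = 0} * 8 ^ n := sum_mul _ _ _
    _ ≤ #P * #(regularFinset V d) := by
        rw [← smul_eq_mul]
        refine sum_le_card_nsmul _ _ _ fun p hp => ?_
        simp only [P, mem_filter, mem_univ, true_and] at hp
        exact card_crossCard_eq_zero_mul_le hδ hδ1 hd hn hp.1 hp.2.1 hp.2.2
    _ ≤ 2 ^ n * 2 ^ n * #(regularFinset V d) := Nat.mul_le_mul_right _ hP
    _ = _ := mul_comm _ _

/-- Some set of at most `n / 55296` vertices spans at least `r` times as many edges as it has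
vertices. -/
def HasDenseSet (G : SimpleGraph V) (r : ℕ) : Prop :=
  ∃ T : Finset V, T.Nonempty ∧ 55296 * #T ≤ Fintype.card V ∧
    r * #T ≤ #{e ∈ T.sym2 | e ∈ G.edgeSet}

/-- A union bound over the size `t`, the set `T` and `r * t` of the edges it spans; `110592` is
`55296` times the bound `2` for the sum of `t / 2 ^ t`. -/
theorem card_hasDenseSet_mul_le {d : ℕ} (hd : 8 ≤ d) (hn : 8 * (d + 1) ≤ Fintype.card V) :
    (#{G ∈ regularFinset V d | HasDenseSet G (d / 4)} : ℝ) * Fintype.card V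
      ≤ 110592 * #(regularFinset V d) := by
  set n := Fintype.card V with hn'
  set r := d / 4 with hr
  have hn0 : (0 : ℝ) < n := by exact_mod_cast (by omega : 0 < n)
  let N (F : Finset (Sym2 V)) : Finset (SimpleGraph V) :=
    {G ∈ regularFinset V d | ∀ e ∈ F, e ∈ G.edgeSet}
  have hN (F : Finset (Sym2 V)) (hF : 4 * #F ≤ n * d) :
      (#(N F) : ℝ) ≤ (4 * d / n : ℝ) ^ #F * #(regularFinset V d) := by
    have h := card_containing_mul_le (by omega : 0 < d) hn F hF
    rw [div_pow, div_mul_eq_mul_div, le_div_iff₀ (by positivity)]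
    exact_mod_cast h
  have hsub : ({G ∈ regularFinset V d | HasDenseSet G r} : Finset (SimpleGraph V)) ⊆
      (Icc 1 (n / 55296)).biUnion fun t => (powersetCard t univ).biUnion fun T : Finset V =>
        (powersetCard (r * t) T.sym2).biUnion N := by
    intro G hG
    simp only [mem_filter] at hG
    obtain ⟨hG, T, hT, hTn, hTr⟩ := hG
    obtain ⟨F, hF, hFc⟩ := exists_subset_card_eq hTr
    simp only [mem_biUnion, mem_Icc, mem_powersetCard]
    refine ⟨#T, ⟨hT.card_pos, by omega⟩, T, ⟨subset_univ _, rfl⟩, F,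
      ⟨hF.trans (filter_subset _ _), hFc⟩, ?_⟩
    simp only [N, mem_filter]
    exact ⟨hG, fun e he => (mem_filter.1 (hF he)).2⟩
  have hterm : ∀ t ∈ Icc 1 (n / 55296),
      (#((powersetCard t univ).biUnion fun T : Finset V =>
        (powersetCard (r * t) T.sym2).biUnion N) : ℝ) ≤
      55296 / n * (t / 2 ^ t) * #(regularFinset V d) := by
    intro t ht
    rw [mem_Icc] at ht
    have hT : ∀ T ∈ powersetCard t (univ : Finset V),
        (#((powersetCard (r * t) T.sym2).biUnion N) : ℝ) ≤
        (t ^ 2).choose (r * t) * ((4 * d / n : ℝ) ^ (r * t) * #(regularFinset V d)) := by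
      intro T hT
      have hTc := (mem_powersetCard.1 hT).2
      have hF : ∀ F ∈ powersetCard (r * t) T.sym2,
          (#(N F) : ℝ) ≤ (4 * d / n : ℝ) ^ (r * t) * #(regularFinset V d) := by
        intro F hF
        have hFc := (mem_powersetCard.1 hF).2
        rw [← hFc]
        refine hN F ?_
        rw [hFc]
        calc 4 * (r * t) = t * (4 * r) := by ring
          _ ≤ n * d := Nat.mul_le_mul (by omega) (by omega)
      have hsym : #T.sym2 ≤ t ^ 2 := by
        rw [card_sym2, hTc, Nat.choose_two_right]
        refine Nat.div_le_of_le_mul ?_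
        simp only [Nat.add_sub_cancel]
        nlinarith
      calc (#((powersetCard (r * t) T.sym2).biUnion N) : ℝ)
          ≤ ∑ F ∈ powersetCard (r * t) T.sym2, (#(N F) : ℝ) := by exact_mod_cast card_biUnion_le
        _ ≤ #(powersetCard (r * t) T.sym2) *
              ((4 * d / n : ℝ) ^ (r * t) * #(regularFinset V d)) := by
            rw [← nsmul_eq_mul]; exact sum_le_card_nsmul _ _ _ hF
        _ ≤ _ := by
            rw [card_powersetCard]
            gcongr
    calc (#((powersetCard t univ).biUnion fun T : Finset V =>
          (powersetCard (r * t) T.sym2).biUnion N) : ℝ)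
        ≤ ∑ T ∈ powersetCard t (univ : Finset V),
            (#((powersetCard (r * t) T.sym2).biUnion N) : ℝ) := by
          exact_mod_cast card_biUnion_le
      _ ≤ #(powersetCard t (univ : Finset V)) * ((t ^ 2).choose (r * t) *
            ((4 * d / n : ℝ) ^ (r * t) * #(regularFinset V d))) := by
          rw [← nsmul_eq_mul]; exact sum_le_card_nsmul _ _ _ hT
      _ = (n.choose t : ℝ) * ((t ^ 2).choose (r * t) * (4 * d / n : ℝ) ^ (r * t)) *
            #(regularFinset V d) := by
          rw [card_powersetCard, card_univ]; ring
      _ ≤ _ := by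
          refine mul_le_mul_of_nonneg_right ?_ (by positivity)
          exact choose_mul_choose_mul_pow_le (by omega) (by omega) (by omega) (by omega)
  have hsum : ∑ t ∈ Icc 1 (n / 55296), (t : ℝ) / 2 ^ t ≤ 2 := by
    refine (sum_le_sum_of_subset_of_nonneg (t := range (n / 55296 + 1)) ?_ ?_).trans ?_
    · intro t ht
      rw [mem_Icc] at ht
      rw [mem_range]
      omega
    · intro t _ _
      positivity
    · rw [sum_range_div_two_pow_le]
      have : (0 : ℝ) ≤ ((n / 55296 : ℕ) + 2) / 2 ^ (n / 55296) := by positivity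
      linarith
  rw [← le_div_iff₀ hn0]
  calc (#{G ∈ regularFinset V d | HasDenseSet G r} : ℝ)
      ≤ ∑ t ∈ Icc 1 (n / 55296), (#((powersetCard t univ).biUnion fun T : Finset V =>
          (powersetCard (r * t) T.sym2).biUnion N) : ℝ) := by
        exact_mod_cast (card_le_card hsub).trans card_biUnion_le
    _ ≤ ∑ t ∈ Icc 1 (n / 55296), 55296 / n * (t / 2 ^ t) * (#(regularFinset V d) : ℝ) :=
        sum_le_sum hterm
    _ = 55296 / n * (∑ t ∈ Icc 1 (n / 55296), (t : ℝ) / 2 ^ t) * #(regularFinset V d) := by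
        rw [mul_sum, sum_mul]
    _ ≤ 55296 / n * 2 * #(regularFinset V d) := by gcongr
    _ = _ := by ring

end

/-! ### Deterministic bound on the variance from expansion. -/

section

variable {V : Type*}

theorem sum_mul_card_le_of_halving (U : ℕ → Finset V) {c : ℝ} (h0 : (#(U 0) : ℝ) ≤ c)
    (h : ∀ j, 2 * #(U (j + 1)) ≤ #(U j)) (J : ℕ) :
    ∑ j ∈ range J, 2 * (j + 1 : ℝ) * #(U j) ≤ 8 * c := by
  have hc : 0 ≤ c := le_trans (by positivity) h0
  have hU : ∀ j, (#(U j) : ℝ) ≤ c / 2 ^ j := by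
    intro j
    induction j with
    | zero => simpa using h0
    | succ j ih =>
      have h' : (2 : ℝ) * #(U (j + 1)) ≤ #(U j) := by exact_mod_cast h j
      have e : c / 2 ^ (j + 1) = c / 2 ^ j / 2 := by rw [pow_succ]; field_simp
      rw [e]
      linarith
  have hsum : ∑ j ∈ range J, (j + 1 : ℝ) / 2 ^ j = 4 - (2 * J + 4) / 2 ^ J := by
    induction J with
    | zero => simp
    | succ J ih => rw [sum_range_succ, ih]; push_cast; field_simp; ring
  calc ∑ j ∈ range J, 2 * (j + 1 : ℝ) * #(U j)
      ≤ ∑ j ∈ range J, 2 * (j + 1 : ℝ) * (c / 2 ^ j) := by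
        gcongr with j _
        exact hU j
    _ = 2 * c * ∑ j ∈ range J, (j + 1 : ℝ) / 2 ^ j := by
        rw [mul_sum]; exact sum_congr rfl fun j _ => by ring
    _ ≤ 2 * c * 4 := by
        rw [hsum]
        gcongr
        have : (0 : ℝ) ≤ (2 * J + 4) / 2 ^ J := by positivity
        linarith
    _ = 8 * c := by ring

variable [Fintype V]

/-- All edges at `S` lie inside `T`, so `T` spans at least `#S * d / 2` edges; if `#S` exceeded `#T
/ 2`, this would make `T` dense. -/
theorem two_mul_card_le_of_not_hasDenseSet {G : SimpleGraph V} {d : ℕ}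
    (hG : G ∈ regularFinset V d) (hdense : ¬ HasDenseSet G (d / 4)) {S T : Finset V}
    (hST : S ⊆ T) (hadj : ∀ x ∈ S, ∀ y, G.Adj x y → y ∈ T)
    (hT : 55296 * #T ≤ Fintype.card V) : 2 * #S ≤ #T := by
  by_contra! hlt
  refine hdense ⟨T, ?_, hT, ?_⟩
  · have : S.Nonempty := card_pos.1 (by omega)
    exact this.mono hST
  · have h1 : #S * d ≤ 2 * #{e ∈ T.sym2 | e ∈ G.edgeSet} := by
      rw [← card_adj_fst hG S]
      refine (card_le_card ?_).trans (card_pairs_mem_le _)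
      rintro ⟨x, y⟩ h
      simp only [mem_filter, mem_univ, true_and, mk_mem_sym2_iff, SimpleGraph.mem_edgeSet] at h ⊢
      exact ⟨⟨hST h.1, hadj x h.1 y h.2⟩, h.2⟩
    have h2 : 4 * (d / 4) * #T ≤ d * (2 * #S) := Nat.mul_le_mul (by omega) hlt.le
    have h3 : d * (2 * #S) = 2 * (#S * d) := by ring
    have h4 : 4 * (d / 4) * #T = 4 * (d / 4 * #T) := by ring
    omega

theorem sum_sub_mean_sq_le (f : V → ℝ) (c : ℝ) :
    ∑ v, (f v - mean f) ^ 2 ≤ ∑ v, (f v - c) ^ 2 := by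
  rcases isEmpty_or_nonempty V with h | h
  · simp
  have hn : (Fintype.card V : ℝ) ≠ 0 := by exact_mod_cast Fintype.card_ne_zero
  have hm : ∑ v, (f v - mean f) = 0 := by
    rw [sum_sub_distrib, mean]
    simp only [sum_const, card_univ, nsmul_eq_mul]
    field_simp
    simp
  have : ∑ v, (f v - c) ^ 2 = ∑ v, (f v - mean f) ^ 2 + 2 * (mean f - c) * ∑ v, (f v - mean f)
      + ∑ v : V, (mean f - c) ^ 2 := by
    rw [mul_sum, ← sum_add_distrib, ← sum_add_distrib]
    exact sum_congr rfl fun v _ => by ring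
  rw [this, hm]
  have : 0 ≤ ∑ v : V, (mean f - c) ^ 2 := sum_nonneg fun _ _ => sq_nonneg _
  linarith

/-- A layer-cake bound: the increments `2 * (j + 1)` telescope to `(M + 1 / 2) ^ 2 - 1 / 4 = M * (M
+ 1)`, so rounding `x` up to an integer suffices. -/
theorem sq_add_half_le_sum (J : ℕ) (x : ℝ) (h1 : -1 ≤ x) (h2 : x ≤ J) :
    (x + 1 / 2) ^ 2 ≤ 1 / 4 + ∑ j ∈ range J, if (j : ℝ) < x then 2 * (j + 1 : ℝ) else 0 := by
  induction J with
  | zero =>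
    simp only [Nat.cast_zero] at h2
    simp only [range_zero, sum_empty]
    nlinarith
  | succ J ih =>
    rcases le_or_gt x J with h | h
    · refine (ih h).trans ?_
      rw [sum_range_succ]
      have : (0 : ℝ) ≤ if (J : ℝ) < x then 2 * (J + 1 : ℝ) else 0 := by
        split_ifs <;> positivity
      linarith
    · have hall : ∑ j ∈ range (J + 1), (if (j : ℝ) < x then 2 * (j + 1 : ℝ) else 0)
          = ∑ j ∈ range (J + 1), 2 * (j + 1 : ℝ) := by
        refine sum_congr rfl fun j hj => if_pos ?_
        have : (j : ℝ) ≤ J := by exact_mod_cast Nat.lt_succ_iff.1 (mem_range.1 hj)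
        linarith
      have hsum : ∀ M : ℕ, ∑ j ∈ range M, 2 * (j + 1 : ℝ) = M * (M + 1) := by
        intro M
        induction M with
        | zero => simp
        | succ M ih => rw [sum_range_succ, ih]; push_cast; ring
      rw [hall, hsum]
      push_cast at h2 ⊢
      have : (0 : ℝ) ≤ J := by positivity
      nlinarith

/-- Take the least value of `f` with at least `c` vertices at or below it. -/
theorem exists_quantile [Nonempty V] (f : V → ℝ) {c : ℝ} (hc : 0 < c)
    (hcn : c ≤ Fintype.card V) :
    ∃ a : ℝ, (#{v | f v < a} : ℝ) < c ∧ c ≤ #{v | f v ≤ a} := by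
  obtain ⟨m, _, hm⟩ := exists_max_image (univ : Finset V) f univ_nonempty
  let s : Finset V := {v | c ≤ #{w | f w ≤ f v}}
  have hs : s.Nonempty := by
    refine ⟨m, ?_⟩
    have : ({w | f w ≤ f m} : Finset V) = univ := by
      ext w; simpa using hm w (mem_univ w)
    simpa [s, this, card_univ] using hcn
  obtain ⟨v, hv, hmin⟩ := exists_min_image s f hs
  refine ⟨f v, ?_, by simpa [s] using hv⟩
  by_contra! hle
  have hne : ({w | f w < f v} : Finset V).Nonempty := by
    rw [← card_pos, ← Nat.cast_pos (α := ℝ)]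
    linarith
  obtain ⟨w, hw, hmax⟩ := exists_max_image _ f hne
  have hws : w ∈ s := by
    simp only [s, mem_filter, mem_univ, true_and]
    refine hle.trans ?_
    exact_mod_cast card_le_card fun x hx => by simpa using hmax x hx
  have h1 := hmin w hws
  have h2 : f w < f v := by simpa using hw
  linarith

theorem variance_le_of_expansion {G : SimpleGraph V} {d : ℕ} {δ : ℝ}
    (hG : G ∈ regularFinset V d) (hδ : 0 < δ) (hδ1 : 55296 * δ ≤ 1)
    (hdense : ¬ HasDenseSet G (d / 4))
    (hcross : ¬ HasUnjoinedPair G δ)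
    {f : V → ℝ} (hf : IsLipschitz G f) : variance f ≤ 1 / 4 + 16 * δ := by
  rcases isEmpty_or_nonempty V with hV | hV
  · simp only [variance, univ_eq_empty, sum_empty, zero_div]
    positivity
  have hn : (0 : ℝ) < Fintype.card V := by exact_mod_cast Fintype.card_pos
  set n := Fintype.card V
  have hδn : 0 < δ * n := by positivity
  obtain ⟨a, hlt, hle⟩ := exists_quantile f hδn (by nlinarith : δ * n ≤ (n : ℝ))
  let L (j : ℕ) : Finset V := {v | (j : ℝ) < a - f v}
  let U (j : ℕ) : Finset V := {v | (j : ℝ) < f v - a - 1}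
  have hL0 : (#(L 0) : ℝ) ≤ δ * n := by
    refine le_trans ?_ hlt.le
    simp [L]
  have hU0 : (#(U 0) : ℝ) ≤ δ * n := by
    -- Across an edge `f` changes by at most `1`, so none joins `{f ≤ a}` to `{f > a + 1}`.
    by_contra! hcon
    refine hcross ⟨univ.filter fun v => f v ≤ a, U 0, ?_, hle, hcon.le, ?_⟩
    · rw [Finset.disjoint_left]
      intro x hx hx'
      simp only [U, mem_filter, mem_univ, true_and, Nat.cast_zero] at hx hx'
      linarith
    · rw [crossCard, card_eq_zero, filter_eq_empty_iff]
      rintro ⟨x, y⟩ _ ⟨hx, hy, hxy⟩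
      simp only [U, mem_filter, mem_univ, true_and, Nat.cast_zero] at hx hy
      have := (abs_le.1 (hf x y hxy)).1
      linarith
  have hsmall (W : ℕ → Finset V) (hW : ∀ j, W (j + 1) ⊆ W j) (h0 : (#(W 0) : ℝ) ≤ δ * n)
      (hadj : ∀ j, ∀ x ∈ W (j + 1), ∀ y, G.Adj x y → y ∈ W j) (j : ℕ) :
      2 * #(W (j + 1)) ≤ #(W j) := by
    refine two_mul_card_le_of_not_hasDenseSet hG hdense (hW j) (hadj j) ?_
    have h1 : #(W j) ≤ #(W 0) := card_le_card (antitone_nat_of_succ_le hW (Nat.zero_le j))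
    have h2 : (55296 : ℝ) * #(W 0) ≤ n := by nlinarith
    have h3 : 55296 * #(W 0) ≤ n := by exact_mod_cast h2
    omega
  have hLj := hsmall L
    (fun j x hx => by
      simp only [L, mem_filter, mem_univ, true_and, Nat.cast_add, Nat.cast_one] at hx ⊢
      linarith) hL0
    (fun j x hx y hxy => by
      simp only [L, mem_filter, mem_univ, true_and, Nat.cast_add, Nat.cast_one] at hx ⊢
      have := (abs_le.1 (hf x y hxy)).1
      linarith)
  have hUj := hsmall U
    (fun j x hx => by
      simp only [U, mem_filter, mem_univ, true_and, Nat.cast_add, Nat.cast_one] at hx ⊢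
      linarith) hU0
    (fun j x hx y hxy => by
      simp only [U, mem_filter, mem_univ, true_and, Nat.cast_add, Nat.cast_one] at hx ⊢
      have := (abs_le.1 (hf x y hxy)).2
      linarith)
  obtain ⟨J, hJ⟩ := exists_nat_ge (∑ v, |f v - a|)
  have hJv (v : V) : |f v - a| ≤ J :=
    (single_le_sum (f := fun v => |f v - a|) (fun _ _ => abs_nonneg _) (mem_univ v)).trans hJ
  -- Values in `[a, a + 1]` lie within `1 / 2` of the centre and account for the `1 / 4`; the excess
  -- beyond either end is charged to the tail sets containing `v`.
  have hpoint (v : V) : (f v - (a + 1 / 2)) ^ 2 ≤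
      1 / 4 + ((∑ j ∈ range J, if v ∈ L j then 2 * (j + 1 : ℝ) else 0) +
        ∑ j ∈ range J, if v ∈ U j then 2 * (j + 1 : ℝ) else 0) := by
    have hb := abs_le.1 (hJv v)
    have hL' : 0 ≤ ∑ j ∈ range J, if v ∈ L j then 2 * (j + 1 : ℝ) else 0 :=
      sum_nonneg fun j _ => by split_ifs <;> positivity
    have hU' : 0 ≤ ∑ j ∈ range J, if v ∈ U j then 2 * (j + 1 : ℝ) else 0 :=
      sum_nonneg fun j _ => by split_ifs <;> positivity
    simp only [L, U, mem_filter, mem_univ, true_and] at hL' hU' ⊢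
    rcases le_total a (f v) with h | h
    · have := sq_add_half_le_sum J (f v - a - 1) (by linarith) (by linarith)
      have e : (f v - (a + 1 / 2)) ^ 2 = (f v - a - 1 + 1 / 2) ^ 2 := by ring
      rw [e]
      linarith
    · have := sq_add_half_le_sum J (a - f v) (by linarith) (by linarith)
      have e : (f v - (a + 1 / 2)) ^ 2 = (a - f v + 1 / 2) ^ 2 := by ring
      rw [e]
      linarith
  have hswap (W : ℕ → Finset V) :
      ∑ v, ∑ j ∈ range J, (if v ∈ W j then 2 * (j + 1 : ℝ) else 0) =
        ∑ j ∈ range J, 2 * (j + 1 : ℝ) * #(W j) := by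
    rw [sum_comm]
    refine sum_congr rfl fun j _ => ?_
    rw [sum_ite_mem, univ_inter, sum_const, nsmul_eq_mul, mul_comm]
  rw [variance, div_le_iff₀ hn]
  calc ∑ v, (f v - mean f) ^ 2 ≤ ∑ v, (f v - (a + 1 / 2)) ^ 2 := sum_sub_mean_sq_le f _
    _ ≤ ∑ v, (1 / 4 + ((∑ j ∈ range J, if v ∈ L j then 2 * (j + 1 : ℝ) else 0) +
        ∑ j ∈ range J, if v ∈ U j then 2 * (j + 1 : ℝ) else 0)) := sum_le_sum fun v _ => hpoint v
    _ = n * (1 / 4) + (∑ j ∈ range J, 2 * (j + 1 : ℝ) * #(L j) +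
          ∑ j ∈ range J, 2 * (j + 1 : ℝ) * #(U j)) := by
        rw [sum_add_distrib, sum_add_distrib, hswap, hswap]
        simp [n]
    _ ≤ n * (1 / 4) + (8 * (δ * n) + 8 * (δ * n)) := by
        gcongr
        · exact sum_mul_card_le_of_halving L hL0 hLj J
        · exact sum_mul_card_le_of_halving U hU0 hUj J
    _ = (1 / 4 + 16 * δ) * n := by ring

end


/-! ### Existence of regular graphs, as Cayley graphs of cyclic groups. -/

theorem regularFinset_nonempty_of_symm {V : Type*} [AddCommGroup V] [Fintype V] (S : Finset V)
    (h0 : (0 : V) ∉ S) (hS : ∀ x ∈ S, -x ∈ S) : (regularFinset V #S).Nonempty := by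
  refine ⟨⟨fun x y => y - x ∈ S, ⟨?_⟩, ⟨?_⟩⟩, ?_⟩
  · intro x y h
    simpa using hS _ h
  · intro x h
    exact h0 (by simpa using h)
  · rw [mem_regularFinset]
    intro x
    refine card_bij (fun y _ => y - x) (by simp) (by simp) ?_
    intro b hb
    exact ⟨b + x, by simpa using hb, by simp⟩

/-- Take the residues `±1, …, ±(d / 2)`, together with the self-inverse `n / 2` when `d` is odd; `n`
is then even. -/
theorem exists_symm_finset_zmod {n d : ℕ} [NeZero n] (hdn : d < n) (heven : Even (n * d)) :
    ∃ S : Finset (ZMod n), #S = d ∧ 0 ∉ S ∧ ∀ x ∈ S, -x ∈ S := by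
  let T : Finset ℕ := {i ∈ range n | (1 ≤ i ∧ i ≤ d / 2) ∨ n - d / 2 ≤ i ∨ (Odd d ∧ 2 * i = n)}
  have hodd : Odd d → Even n := fun h => (Nat.even_mul.1 heven).resolve_right
    (Nat.not_even_iff_odd.2 h)
  have hT : #T = d := by
    have hTeq : T = Icc 1 (d / 2) ∪ (Ico (n - d / 2) n ∪ if Odd d then {n / 2} else ∅) := by
      ext i
      simp only [T, mem_filter, mem_range, mem_union, mem_Icc, mem_Ico]
      split_ifs with h
      · obtain ⟨m, hm⟩ := hodd h
        simp only [h, true_and, mem_singleton]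
        omega
      · simp only [h, false_and, or_false, notMem_empty]
        omega
    rw [hTeq, card_union_of_disjoint, card_union_of_disjoint]
    · split_ifs with h
      · obtain ⟨m, hm⟩ := h
        simp only [Nat.card_Icc, Nat.card_Ico, card_singleton]
        omega
      · obtain ⟨m, hm⟩ := Nat.not_odd_iff_even.1 h
        simp only [Nat.card_Icc, Nat.card_Ico, card_empty]
        omega
    · split_ifs with h
      · obtain ⟨m, hm⟩ := hodd h
        rw [disjoint_singleton_right, mem_Ico]
        obtain ⟨l, hl⟩ := h
        omega
      · exact disjoint_empty_right _
    · rw [Finset.disjoint_left]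
      intro i hi
      rw [mem_Icc] at hi
      rw [mem_union, mem_Ico]
      split_ifs with h
      · obtain ⟨m, hm⟩ := hodd h
        obtain ⟨l, hl⟩ := h
        rw [mem_singleton]
        omega
      · simp only [notMem_empty, or_false]
        omega
  have hlt (x : ZMod n) : x.val < n := ZMod.val_lt x
  refine ⟨univ.filter fun x : ZMod n => x.val ∈ T, ?_, ?_, ?_⟩
  · rw [← hT]
    refine card_bij (fun (x : ZMod n) _ => x.val) (by simp) ?_ ?_
    · intro x _ y _ h
      exact ZMod.val_injective n h
    · intro b hb
      have hbn : b < n := mem_range.1 (mem_filter.1 hb).1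
      exact ⟨b, by simpa [ZMod.val_natCast_of_lt hbn] using hb, ZMod.val_natCast_of_lt hbn⟩
  · simp only [T, mem_filter, mem_univ, true_and, mem_range, ZMod.val_zero]
    omega
  · intro x hx
    have hx0 : x ≠ 0 := by
      rintro rfl
      simp only [T, mem_filter, mem_univ, true_and, mem_range, ZMod.val_zero] at hx
      omega
    have := hlt x
    have hx1 : x.val ≠ 0 := by rwa [Ne, ZMod.val_eq_zero]
    simp only [T, mem_filter, mem_univ, true_and, mem_range, ZMod.neg_val, hx0, if_false] at hx ⊢
    refine ⟨by omega, ?_⟩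
    rcases hx.2 with h | h | h
    · right; left; omega
    · left; omega
    · right; right; exact ⟨h.1, by omega⟩

theorem regularFinset_nonempty {n d : ℕ} (hdn : d < n) (heven : Even (n * d)) :
    (regularFinset (Fin n) d).Nonempty := by
  obtain ⟨m, rfl⟩ : ∃ m, n = m + 1 := ⟨n - 1, by omega⟩
  obtain ⟨S, hS, h0, hneg⟩ := exists_symm_finset_zmod hdn heven
  rw [← hS]
  exact regularFinset_nonempty_of_symm S h0 hneg

/-! ### Passage to probabilities and the limit. -/

theorem coe_regularFinset (n d : ℕ) : (regularFinset (Fin n) d : Set _) = regularGraphs n d := by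
  ext G
  rw [mem_coe, mem_regularFinset, regularGraphs, Set.mem_ofPred_eq]
  refine forall_congr' fun x => ?_
  rw [← SimpleGraph.card_neighborFinset_eq_degree, SimpleGraph.neighborFinset_eq_filter]

theorem regularProb_eq (n d : ℕ) (P : SimpleGraph (Fin n) → Prop) :
    regularProb n d P = (#{G ∈ regularFinset (Fin n) d | P G} : ℝ) / #(regularFinset (Fin n) d) := by
  have : {G | G ∈ regularGraphs n d ∧ P G} =
      (({G ∈ regularFinset (Fin n) d | P G} : Finset _) : Set (SimpleGraph (Fin n))) := by
    rw [← coe_regularFinset]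
    ext G
    simp
  rw [regularProb, this, ← coe_regularFinset, Set.ncard_coe_finset, Set.ncard_coe_finset]

theorem le_regularProb_spread {n d : ℕ} {δ ε : ℝ} (hδ : 0 < δ) (hδ1 : 55296 * δ ≤ 1)
    (hδε : 16 * δ < ε) (hd : 8 ≤ d) (hdδ : 128 ≤ δ ^ 2 * d) (hn : 8 * (d + 1) ≤ n)
    (hnδ : 6 * d ≤ δ ^ 2 * n) (heven : Even (n * d)) :
    1 - (1 / 2 ^ n + 110592 / n : ℝ) ≤
      regularProb n d fun G => spread G < ((1 / 4 + ε : ℝ) : EReal) := by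
  have hpos : (0 : ℝ) < #(regularFinset (Fin n) d) := by
    exact_mod_cast (regularFinset_nonempty (by omega) heven).card_pos
  have hn0 : (0 : ℝ) < n := by exact_mod_cast (by omega : 0 < n)
  have h1 := card_hasUnjoinedPair_mul_le (V := Fin n) hδ (by linarith) hdδ
    (by simpa using hnδ)
  have h2 := card_hasDenseSet_mul_le (V := Fin n) hd (by simpa using hn)
  rw [Fintype.card_fin] at h1 h2
  rw [regularProb_eq, le_div_iff₀ hpos]
  have hsub : regularFinset (Fin n) d ⊆
      ({G ∈ regularFinset (Fin n) d | spread G < ((1 / 4 + ε : ℝ) : EReal)} : Finset _) ∪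
      (({G ∈ regularFinset (Fin n) d | HasUnjoinedPair G δ} : Finset _) ∪
      ({G ∈ regularFinset (Fin n) d | HasDenseSet G (d / 4)} : Finset _)) := by
    intro G hG
    simp only [mem_union, mem_filter, hG, true_and]
    by_contra! hcon
    obtain ⟨hs, hc, hD⟩ := hcon
    refine absurd hs (not_le.2 ?_)
    -- The supremum is only bounded weakly by `1 / 4 + 16 * δ`; the slack `16 * δ < ε` restores
    -- strictness.
    refine lt_of_le_of_lt (b := ((1 / 4 + 16 * δ : ℝ) : EReal)) ?_ ?_
    · refine iSup₂_le fun f hf => ?_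
      rw [EReal.coe_le_coe_iff]
      refine variance_le_of_expansion hG hδ hδ1 hD hc hf
    · rw [EReal.coe_lt_coe_iff]
      linarith
  have hcard := (card_le_card hsub).trans ((card_union_le _ _).trans
    (Nat.add_le_add_left (card_union_le _ _) _))
  rw [← Nat.cast_le (α := ℝ)] at hcard
  have h1' : (#{G ∈ regularFinset (Fin n) d | HasUnjoinedPair G δ} : ℝ) ≤
      1 / 2 ^ n * #(regularFinset (Fin n) d) := by
    rw [one_div_mul_eq_div, le_div_iff₀ (by positivity)]
    exact_mod_cast h1
  have h2' : (#{G ∈ regularFinset (Fin n) d | HasDenseSet G (d / 4)} : ℝ) ≤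
      110592 / n * #(regularFinset (Fin n) d) := by
    rwa [div_mul_eq_mul_div, le_div_iff₀ hn0]
  simp only [Nat.cast_add] at hcard
  have hgood : (1 - (1 / 2 ^ n + 110592 / n : ℝ)) * #(regularFinset (Fin n) d) ≤
      #{G ∈ regularFinset (Fin n) d | spread G < ((1 / 4 + ε : ℝ) : EReal)} := by
    linarith
  refine hgood.trans_eq ?_
  congr!

end
end GraphSpread

theorem theorem5 (ε : ℝ) (hε : 0 < ε) :
    ∃ d₀ : ℕ, ∀ d : ℕ, d₀ ≤ d →
      GraphSpread.RegularWhp d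
        (fun n (G : SimpleGraph (Fin n)) =>
          GraphSpread.spread G < ((1 / 4 + ε : ℝ) : EReal)) := by
  obtain ⟨δ, hδ, hδ1, hδε⟩ : ∃ δ : ℝ, 0 < δ ∧ 55296 * δ ≤ 1 ∧ 16 * δ < ε := by
    refine ⟨min (1 / 55296) (ε / 32), by positivity, ?_, ?_⟩
    · linarith [min_le_left (1 / 55296 : ℝ) (ε / 32)]
    · linarith [min_le_right (1 / 55296 : ℝ) (ε / 32)]
  obtain ⟨d₁, hd₁⟩ := exists_nat_ge (128 / δ ^ 2)
  refine ⟨max 8 d₁, fun d hd => ?_⟩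
  have hd8 : 8 ≤ d := (le_max_left _ _).trans hd
  have hdδ : 128 ≤ δ ^ 2 * d := by
    have h : (d₁ : ℝ) ≤ d := by exact_mod_cast (le_max_right _ _).trans hd
    have := hd₁.trans h
    rwa [div_le_iff₀' (by positivity)] at this
  obtain ⟨n₁, hn₁⟩ := exists_nat_ge (6 * d / δ ^ 2)
  have hlim : Filter.Tendsto (fun n : ℕ => 1 - (1 / 2 ^ n + 110592 / n : ℝ)) Filter.atTop
      (nhds 1) := by
    have h1 : Filter.Tendsto (fun n : ℕ => (1 / 2 ^ n : ℝ)) Filter.atTop (nhds 0) := by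
      simpa using tendsto_pow_atTop_nhds_zero_of_lt_one (r := (1 / 2 : ℝ)) (by norm_num)
        (by norm_num)
    simpa using tendsto_const_nhds.sub (h1.add (tendsto_const_div_atTop_nhds_zero_nat 110592))
  refine tendsto_of_tendsto_of_tendsto_of_le_of_le' (hlim.mono_left inf_le_left)
    tendsto_const_nhds ?_ (Filter.Eventually.of_forall fun n => ?_)
  · rw [Filter.eventually_inf_principal]
    filter_upwards [Filter.eventually_ge_atTop (max n₁ (8 * (d + 1)))] with n hn heven
    have hn8 : 8 * (d + 1) ≤ n := (le_max_right _ _).trans hn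
    refine GraphSpread.le_regularProb_spread hδ hδ1 hδε hd8 hdδ hn8 ?_ heven
    have h : (n₁ : ℝ) ≤ n := by exact_mod_cast (le_max_left _ _).trans hn
    have := hn₁.trans h
    rwa [div_le_iff₀' (by positivity)] at this
  -- The upper bound holds for every `n`, also when there is no regular graph and the quotient is `0
  -- / 0 = 0`.
  · rw [GraphSpread.regularProb_eq]
    refine div_le_one_of_le₀ ?_ (by positivity)
    exact_mod_cast Finset.card_le_card (Finset.filter_subset _ _)
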